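/- **Setting.** Let $d\ge 1$ and let $f\in\mathbb R[x,y,z]$ be a form of degree $d$ whose complex projective plane curve $\mathcal V_{\mathbb C}(f)$ is smooth. For a form $g\in\mathbb C[x,y,z]$ without common factor with $f$, let $f.g=\sum_P I_P(f,g)\,P$ be the intersection divisor. A divisor $D$ on $\mathcal V_{\mathbb C}(f)$ is a *real-contact divisor* if $f.g=D+\overline D$ for some real form $g$. Bars denote complex conjugation (of points, of divisors, and of the coefficients of polynomials). **The matrices $A_D$.** Let $D$ be a real-contact divisor of degree $\binom d2$. By $A_D=(a_{jk})_{1\le j,k\le d}$ we denote any matrix of forms in $\mathbb C[x,y,z]$ of degree $d-1$ obtained as follows: $a_{11}\in\mathbb R[x,y,z]$ is a form of degree $d-1$ with $f.a_{11}=D+\overline D$; the first row $a_{11},\dots,a_{1d}$ is a linearly independent family over $\mathbb C$ in the space of the forms $g$ of degree $d-1$ with $f.g\ge D$ (together with $g=0$); for $2\le j\le k\le d$, $\overline{a_{1j}}\,a_{1k}=pf+a_{jk}a_{11}$ for some $p\in\mathbb C[x,y,z]$ (depending on $j,k$), with $a_{jj}$ real; and $a_{kj}=\overline{a_{jk}}$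 for $j<k$. **Hyperbolicity and interlacing.** $f$ is *hyperbolic* with respect to $e\in\mathbb R^3$ if $f(e)\ne0$ and for every $a\in\mathbb R^3$ all roots of $f(te+a)\in\mathbb R[t]$ are real. For such $f$, a real form $g$ of degree $d-1$ *interlaces $f$ with respect to $e$* if for every $a\in\mathbb R^3$ the polynomials $f(te+a)$ and $g(te+a)$ have degrees $d$ and $d-1$ and only real roots $\alpha_1\le\dots\le\alpha_d$ and $\beta_1\le\dots\le\beta_{d-1}$, and $\alpha_i\le\beta_i\le\alpha_{i+1}$ for $1\le i\le d-1$. **Theorem.** Let $f$ and $D$ be as above and let $A_D$ be any matrix obtained from $D$ in this way. (a) Every entry of the adjugate matrix $A_D^{\mathrm{adj}}$ is divisible by $f^{d-2}$, and all entries of $M_D=\frac1{f^{d-2}}A_D^{\mathrm{adj}}$ are linear forms (possibly zero). (For $d=1$ this is read as $M_D=f\cdot A_D^{\mathrm{adj}}=(f)$.) Furthermore there is $\gamma\in\mathbb R$ with $\det(M_D)=\gamma f$. (b) If $f$ is hyperbolic with respect to $e\in\mathbb R^3$ and $a_{11}=(A_D)_{11}$ interlaces $f$ with respect to $e$, then $\gamma\ne0$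 and the Hermitian matrix $M_D(e)$ is positive definite or negative definite. -/

import Mathlib

open scoped LinearAlgebra.Projectivization ComplexOrder

noncomputable section

namespace PlaneCurve

/-- Forms in `x, y, z` over `K` are elements of this ring satisfying `MvPolynomial.IsHomogeneous`. -/
abbrev Poly3 (K : Type) [CommSemiring K] : Type := MvPolynomial (Fin 3) K

/-- The complex projective plane. -/
abbrev P2 : Type := ℙ ℂ (Fin 3 → ℂ)

/-- A real polynomial, regarded as a complex one. -/
abbrev toC (f : Poly3 ℝ) : Poly3 ℂ := MvPolynomial.map (algebraMap ℝ ℂ) f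

/-- Complex conjugation of the coefficients of a polynomial. -/
abbrev conjPoly (g : Poly3 ℂ) : Poly3 ℂ := MvPolynomial.map (starRingEnd ℂ) g

/-- The projective plane curve cut out by a form `f`. -/
def curve (f : Poly3 ℂ) : Set P2 := {P | MvPolynomial.eval P.rep f = 0}

/-- The curve defined by `f` is smooth: the gradient of `f` vanishes at no point of it. -/
def IsSmooth (f : Poly3 ℂ) : Prop :=
  ∀ v : Fin 3 → ℂ, v ≠ 0 → MvPolynomial.eval v f = 0 →
    ∃ i, MvPolynomial.eval v (MvPolynomial.pderiv i f) ≠ 0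

/-! ### Intersection multiplicities -/

/-- The homogeneous prime ideal of a point `P = [p]`: the polynomials that vanish on the line
`{t p}`, that is, the kernel of `ℂ[x, y, z] → ℂ[t]`, `x_i ↦ p_i t`. -/
def pointIdeal (P : P2) : Ideal (Poly3 ℂ) :=
  RingHom.ker (MvPolynomial.aeval (R := ℂ)
    (fun i => Polynomial.C (P.rep i) * (Polynomial.X : Polynomial ℂ)))

instance pointIdeal_isPrime (P : P2) : (pointIdeal P).IsPrime :=
  RingHom.ker_isPrime _

/-- The intersection multiplicity `I_P(f, g)` of two forms at `P`: the length of the localization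
of `ℂ[x, y, z] / (f, g)` at the homogeneous prime ideal of `P`. -/
def interMult (f g : Poly3 ℂ) (P : P2) : ℕ∞ :=
  Module.length (Localization.AtPrime (pointIdeal P))
    (Localization.AtPrime (pointIdeal P) ⧸
      (Ideal.span {f, g}).map (algebraMap (Poly3 ℂ) (Localization.AtPrime (pointIdeal P))))

/-! ### Divisors -/

/-- The group of divisors on the curve defined by `f`: the finite formal integer combinations of
points of the plane all of which lie on the curve. -/
def Div (f : Poly3 ℂ) : Submodule ℤ (P2 →₀ ℤ) := Finsupp.supported ℤ ℤ (curve f)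

/-- Complex conjugation on the projective plane. -/
def conjPt : P2 → P2 :=
  Projectivization.map (starLinearEquiv ℂ : (Fin 3 → ℂ) ≃ₗ⋆[ℂ] (Fin 3 → ℂ)).toLinearMap
    (starLinearEquiv ℂ : (Fin 3 → ℂ) ≃ₗ⋆[ℂ] (Fin 3 → ℂ)).injective

/-- The conjugate divisor. -/
def conjDiv (D : P2 →₀ ℤ) : P2 →₀ ℤ := D.mapDomain conjPt

/-- The degree of a divisor. -/
def divDegree (D : P2 →₀ ℤ) : ℤ := D.sum fun _ n => n

/-- `f.g = E`: the forms `f` and `g` have no common factor, and their intersection divisor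
`∑ I_P(f, g) P` is `E`. -/
def InterDivEq (f g : Poly3 ℂ) (E : P2 →₀ ℤ) : Prop :=
  IsRelPrime f g ∧ 0 ≤ E ∧ ∀ P, interMult f g P = ((E P).toNat : ℕ∞)

/-- `f.g ≥ D`. (For `g = 0` this holds, so that the `g` of a given degree form a vector space.) -/
def InterDivGE (f g : Poly3 ℂ) (D : P2 →₀ ℤ) : Prop :=
  ∀ P, ((D P).toNat : ℕ∞) ≤ interMult f g P

/-- `D` is a real-contact divisor of the curve defined by `f`: a divisor on that curve for which
some real form `g` satisfies `f.g = D + conj D`. -/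
def IsRealContactDivisor (f : Poly3 ℝ) (D : P2 →₀ ℤ) : Prop :=
  D ∈ Div (toC f) ∧ ∃ (g : Poly3 ℝ) (m : ℕ), g.IsHomogeneous m ∧
    InterDivEq (toC f) (toC g) (D + conjDiv D)

/-! ### The construction -/

/-- `A` is one of the matrices `A_D` that Dixon's construction produces from the form `f` of degree
`d` and the divisor `D`. -/
structure IsDixonMatrix {d : ℕ} [NeZero d] (f : Poly3 ℝ) (D : P2 →₀ ℤ)
    (A : Matrix (Fin d) (Fin d) (Poly3 ℂ)) : Prop where
  /-- The entries are forms of degree `d - 1`. -/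
  homogeneous : ∀ j k, (A j k).IsHomogeneous (d - 1)
  /-- The entry `a₁₁` is real and `f.a₁₁ = D + conj D`. -/
  corner : ∃ a : Poly3 ℝ, A 0 0 = toC a ∧ InterDivEq (toC f) (toC a) (D + conjDiv D)
  /-- The first row lies in the space of the `g` with `f.g ≥ D`. -/
  row_ge : ∀ k, InterDivGE (toC f) (A 0 k) D
  /-- The first row is linearly independent. -/
  row_indep : LinearIndependent ℂ (fun k => A 0 k)
  /-- For the indices `j ≤ k` after the first, `conj a₁ⱼ * a₁ₖ = p f + aⱼₖ a₁₁` for some `p`. -/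
  entry : ∀ j k, 0 < j → j ≤ k →
    ∃ p : Poly3 ℂ, conjPoly (A 0 j) * A 0 k = p * toC f + A j k * A 0 0
  /-- `aₖⱼ = conj aⱼₖ`; for `j = k` this says that `aⱼⱼ` is real. -/
  hermitian : ∀ j k, A k j = conjPoly (A j k)

/-! ### Hyperbolicity and interlacing -/

/-- The univariate polynomial `f(t e + a)`. -/
def restrictLine (f : Poly3 ℝ) (e a : Fin 3 → ℝ) : Polynomial ℝ :=
  MvPolynomial.aeval (fun i => Polynomial.X * Polynomial.C (e i) + Polynomial.C (a i)) f

/-- The form `f` is hyperbolic with respect to `e`: `f(e) ≠ 0` and all complex roots of every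
`f(t e + a)` are real. -/
def IsHyperbolic (f : Poly3 ℝ) (e : Fin 3 → ℝ) : Prop :=
  MvPolynomial.eval e f ≠ 0 ∧
    ∀ (a : Fin 3 → ℝ) (z : ℂ), Polynomial.aeval z (restrictLine f e a) = 0 → z.im = 0

/-- `q` interlaces `p`: they have degrees `n` and `n + 1` for some `n`, only real roots, and the
ordered roots, repeated with multiplicity, satisfy `αᵢ ≤ βᵢ ≤ αᵢ₊₁`. -/
def Interlaces (q p : Polynomial ℝ) : Prop :=
  ∃ (n : ℕ) (α : Fin (n + 1) → ℝ) (β : Fin n → ℝ),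
    p.degree = ((n + 1 : ℕ) : WithBot ℕ) ∧ q.degree = (n : WithBot ℕ) ∧
    Monotone α ∧ Monotone β ∧
    p.roots = Finset.univ.val.map α ∧ q.roots = Finset.univ.val.map β ∧
    ∀ i : Fin n, α i.castSucc ≤ β i ∧ β i ≤ α i.succ

/-- The form `g` interlaces the form `f` of degree `d` with respect to `e`. -/
def InterlacesAt (d : ℕ) (g f : Poly3 ℝ) (e : Fin 3 → ℝ) : Prop :=
  IsHyperbolic f e ∧ g.IsHomogeneous (d - 1) ∧
    ∀ a : Fin 3 → ℝ, Interlaces (restrictLine g e a) (restrictLine f e a)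

/-- The complex matrix `M(e)`, for a matrix `M` of polynomials and a real point `e`. -/
def evalMatrix {d : ℕ} (M : Matrix (Fin d) (Fin d) (Poly3 ℂ)) (e : Fin 3 → ℝ) :
    Matrix (Fin d) (Fin d) ℂ :=
  M.map (MvPolynomial.eval (fun i => (e i : ℂ)))

end PlaneCurve

end

/-! Write `a` for the real form `a₁₁`. Modulo `f`, `a A` is the rank-one matrix with entries `conj
a₁ⱼ * a₁ₖ`. Expanding a `k × k` minor of a rank-one matrix plus `f C` row by row, every term with
two rank-one rows vanishes, so `f ^ (k - 1)` divides it. Since `a` is prime to `f`, the same power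
divides the minors of `A` (`Matrix.pow_dvd_det_of_isRelPrime`). Counting degrees, `adj A = f ^ (d -
2) M` with `M` linear and `det A = c f ^ (d - 1)` with `c` constant, real because `A` is Hermitian.
From `det (adj A) = (det A) ^ (d - 1)` follows `det M = c ^ (d - 1) f`.

For definiteness, take `x ≠ 0`, `g = x* A x` and `l = ∑ xₖ a₁ₖ ≠ 0`. Then `a g = |l|²` at the real
zeros of `f`. On a generic real line in direction `e`, the zeros `αᵢ` of `f` are separated strictly
by those of `a`, and Lagrange interpolation at the `αᵢ` writes `a(e) g(e)` as a sum of `|l(αᵢ)|²`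
with positive weights (`interlacing_leadingCoeff`). So `a(e) A(e)` is positive definite, and `M(e)`
is a nonzero real multiple of its inverse. Genericity comes from a Bézout identity for `f` and `a`
on the universal line (`exists_generic`). -/

/-- A matrix that has rank one modulo `f` has a determinant divisible by `f ^ (n - 1)`. -/
theorem Matrix.pow_dvd_det_of_dvd_sub_mul {R : Type*} [CommRing R] {n : ℕ}
    (B : Matrix (Fin n) (Fin n) R) (f : R) (u v : Fin n → R)
    (h : ∀ i j, f ∣ B i j - u i * v j) : f ^ (n - 1) ∣ B.det := by
  choose C hC using h
  have hB : B = (fun i => u i • v) + fun i => f • C i := by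
    ext i j
    simp [← hC]
  have hdet : B.det = Matrix.detRowAlternating B := rfl
  -- Multilinear expansion: `s` is the set of rows taken from the rank-one part.
  rw [hdet, hB, AlternatingMap.map_add_univ]
  refine Finset.dvd_sum fun s _ => ?_
  have hs : (s.piecewise (fun i => u i • v) fun i => f • C i) =
      fun i => (s.piecewise u fun _ => f) i • (s.piecewise (fun _ => v) C) i := by
    funext i
    by_cases hi : i ∈ s <;> simp [hi]
  rw [hs, AlternatingMap.map_smul_univ]
  rcases Nat.lt_or_ge 1 s.card with h1 | h1
  · obtain ⟨i, hi, j, hj, hij⟩ := Finset.one_lt_card.mp h1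
    rw [AlternatingMap.map_eq_zero_of_eq _ _ (i := i) (j := j) (by simp [hi, hj]) hij, smul_zero]
    exact dvd_zero _
  -- At most one row is a multiple of `v`; the other rows, at least `n - 1`, each contribute a
  -- factor `f`.
  · refine Dvd.dvd.mul_right ?_ _
    rw [Finset.prod_piecewise, Finset.prod_const]
    refine Dvd.dvd.mul_left (pow_dvd_pow _ ?_) _
    rw [← Finset.compl_eq_univ_sdiff, Finset.card_compl, Fintype.card_fin]
    omega

/-! ### Degrees of cofactors, determinants and adjugates -/

namespace MvPolynomial

theorem IsHomogeneous.of_mul_left {σ R : Type*} [CommRing R] [IsDomain R]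
    {p q : MvPolynomial σ R} {m k : ℕ} (hp : p.IsHomogeneous m) (hp0 : p ≠ 0)
    (hpq : (p * q).IsHomogeneous (m + k)) : q.IsHomogeneous k := by
  have key : ∀ j, j ≠ k → homogeneousComponent j q = 0 := by
    intro j hj
    -- Multiplication by `p` shifts homogeneous components by `m`.
    have h1 : homogeneousComponent (m + j) (p * q) = p * homogeneousComponent j q := by
      conv_lhs => rw [← sum_homogeneousComponent q, Finset.mul_sum, map_sum]
      have : ∀ i, homogeneousComponent (m + j) (p * homogeneousComponent i q) =
          if j = i then p * homogeneousComponent i q else 0 := by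
        intro i
        rw [homogeneousComponent_of_mem (hp.mul (homogeneousComponent_isHomogeneous i q))]
        simp
      simp only [this, Finset.sum_ite_eq, Finset.mem_range]
      split_ifs with h
      · rfl
      · rw [homogeneousComponent_eq_zero _ _ (by omega), mul_zero]
    rw [homogeneousComponent_of_mem hpq, if_neg (by omega)] at h1
    exact (mul_eq_zero.mp h1.symm).resolve_left hp0
  rw [← sum_homogeneousComponent q]
  refine IsHomogeneous.sum _ _ _ fun i _ => ?_
  by_cases hi : i = k
  · exact hi ▸ homogeneousComponent_isHomogeneous i q
  · rw [key i hi]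
    exact isHomogeneous_zero _ _ _

theorem isHomogeneous_det {σ R : Type*} [CommRing R] {n m : ℕ}
    (B : Matrix (Fin n) (Fin n) (MvPolynomial σ R)) (h : ∀ i j, (B i j).IsHomogeneous m) :
    B.det.IsHomogeneous (n * m) := by
  rw [Matrix.det_apply]
  refine IsHomogeneous.sum _ _ _ fun τ _ => ?_
  have : (∏ i, B (τ i) i).IsHomogeneous (n * m) := by
    simpa using IsHomogeneous.prod Finset.univ (fun i => B (τ i) i) (fun _ => m) fun i _ => h _ _
  rcases Int.units_eq_one_or (Equiv.Perm.sign τ) with h1 | h1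
  · simpa [h1] using this
  · simpa [h1] using this.neg

theorem isHomogeneous_adjugate {σ R : Type*} [CommRing R] {n m : ℕ}
    (B : Matrix (Fin (n + 1)) (Fin (n + 1)) (MvPolynomial σ R))
    (h : ∀ i j, (B i j).IsHomogeneous m) (i j : Fin (n + 1)) :
    (B.adjugate i j).IsHomogeneous (n * m) := by
  rw [Matrix.adjugate_fin_succ_eq_det_submatrix]
  have := isHomogeneous_det (B.submatrix j.succAbove i.succAbove) fun a b => h _ _
  rcases neg_one_pow_eq_or (MvPolynomial σ R) (j + i : ℕ) with h1 | h1
  · simpa [h1] using this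
  · simpa [h1] using this.neg

end MvPolynomial

/-! ### Cancelling a factor prime to `f` -/

namespace Matrix

theorem pow_dvd_det_of_isRelPrime {R : Type*} [CommRing R] [IsDomain R] [DecompositionMonoid R]
    {n : ℕ} (B : Matrix (Fin n) (Fin n) R) (f a : R) (hfa : IsRelPrime f a) (u v : Fin n → R)
    (h : ∀ i j, f ∣ a * B i j - u i * v j) : f ^ (n - 1) ∣ B.det := by
  have h1 := pow_dvd_det_of_dvd_sub_mul (a • B) f u v h
  rw [det_smul] at h1
  exact IsRelPrime.dvd_of_dvd_mul_left (hfa.pow_left.pow_right) h1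

theorem pow_dvd_adjugate_of_isRelPrime {R : Type*} [CommRing R] [IsDomain R]
    [DecompositionMonoid R] {n : ℕ} (B : Matrix (Fin (n + 1)) (Fin (n + 1)) R) (f a : R)
    (hfa : IsRelPrime f a) (u v : Fin (n + 1) → R)
    (h : ∀ i j, f ∣ a * B i j - u i * v j) (i j : Fin (n + 1)) :
    f ^ (n - 1) ∣ B.adjugate i j := by
  rw [adjugate_fin_succ_eq_det_submatrix]
  exact (pow_dvd_det_of_isRelPrime (B.submatrix j.succAbove i.succAbove) f a hfa
    (fun k => u (j.succAbove k)) (fun k => v (i.succAbove k)) fun _ _ => h _ _).mul_left _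

end Matrix

/-! ### The linear matrix and its determinant -/

namespace PlaneCurve
open MvPolynomial

theorem conjPoly_toC (f : Poly3 ℝ) : conjPoly (toC f) = toC f := by
  rw [conjPoly, toC, MvPolynomial.map_map]
  have h : (starRingEnd ℂ).comp (algebraMap ℝ ℂ) = algebraMap ℝ ℂ :=
    RingHom.ext fun x => Complex.conj_ofReal x
  rw [h]

theorem conjPoly_conjPoly (g : Poly3 ℂ) : conjPoly (conjPoly g) = g := by
  rw [conjPoly, conjPoly, MvPolynomial.map_map]
  simpa using MvPolynomial.map_id g

/-- Modulo `f`, a Dixon matrix scaled by its corner entry has rank one. -/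
theorem IsDixonMatrix.dvd_sub {d : ℕ} [NeZero d] {f : Poly3 ℝ} {D : P2 →₀ ℤ}
    {A : Matrix (Fin d) (Fin d) (Poly3 ℂ)} (hA : IsDixonMatrix f D A) (j k : Fin d) :
    toC f ∣ A 0 0 * A j k - conjPoly (A 0 j) * A 0 k := by
  have main : ∀ j k : Fin d, j ≤ k → toC f ∣ A 0 0 * A j k - conjPoly (A 0 j) * A 0 k := by
    intro j k hjk
    rcases eq_or_ne j 0 with rfl | hj
    · rw [← hA.hermitian 0 0, sub_self]
      exact dvd_zero _
    · obtain ⟨p, hp⟩ := hA.entry j k (Fin.pos_iff_ne_zero.mpr hj) hjk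
      exact ⟨-p, by rw [hp]; ring⟩
  rcases le_total j k with h | h
  · exact main j k h
  · obtain ⟨q, hq⟩ := main k j h
    -- Below the diagonal, conjugate the relation at `(k, j)`: `f` is real and `A` is Hermitian.
    refine ⟨conjPoly q, ?_⟩
    have := congrArg conjPoly hq
    simp only [map_sub, map_mul, conjPoly] at this
    change conjPoly (A 0 0) * conjPoly (A k j) - conjPoly (conjPoly (A 0 k)) * conjPoly (A 0 j) =
      conjPoly (toC f) * conjPoly q at this
    rw [← hA.hermitian, ← hA.hermitian, conjPoly_conjPoly, conjPoly_toC] at this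
    rw [← this]
    ring

/-- A form that is real and a complex multiple of a nonzero real form is a real multiple. -/
theorem exists_real_of_conjPoly_eq {f : Poly3 ℝ} (hf : f ≠ 0) {c : ℂ}
    (h : conjPoly (C c * toC f) = C c * toC f) : ∃ γ : ℝ, (γ : ℂ) = c := by
  have h1 : C (starRingEnd ℂ c) * toC f = C c * toC f := by
    rw [← h, conjPoly, map_mul, map_C]
    congr 1
    exact (conjPoly_toC f).symm
  have hf' : toC f ≠ 0 := by
    intro h0
    exact hf (map_injective _ (algebraMap ℝ ℂ).injective (by simpa using h0))
  exact ⟨c.re, Complex.conj_eq_iff_re.mp (C_injective _ _ (mul_right_cancel₀ hf' h1))⟩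

theorem conjPoly_det {d : ℕ} {A : Matrix (Fin d) (Fin d) (Poly3 ℂ)}
    (hA : ∀ j k, A k j = conjPoly (A j k)) : conjPoly A.det = A.det := by
  rw [conjPoly, RingHom.map_det, ← Matrix.det_transpose]
  congr 1
  ext1 j k
  exact (hA k j).symm

/-- The adjugate of a Dixon matrix is `f ^ (n - 1)` times a matrix of linear forms, whose
determinant is a real multiple of `f`. -/
theorem IsDixonMatrix.exists_linear {n : ℕ} {f : Poly3 ℝ} (hf : f.IsHomogeneous (n + 1))
    (hf0 : f ≠ 0) {D : P2 →₀ ℤ} {A : Matrix (Fin (n + 1)) (Fin (n + 1)) (Poly3 ℂ)}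
    (hA : IsDixonMatrix f D A) :
    (∀ i j, toC f ^ (n - 1) ∣ A.adjugate i j) ∧
    ∃ M : Matrix (Fin (n + 1)) (Fin (n + 1)) (Poly3 ℂ),
      toC f ^ n • M = toC f • A.adjugate ∧ (∀ i j, (M i j).IsHomogeneous 1) ∧
      ∃ γ : ℝ, M.det = C (γ : ℂ) * toC f := by
  obtain ⟨a, ha, hfa, -⟩ := hA.corner
  rw [← ha] at hfa
  have hfC : (toC f).IsHomogeneous (n + 1) := hf.map _
  have hfC0 : toC f ≠ 0 := by
    intro h0
    exact hf0 (map_injective _ (algebraMap ℝ ℂ).injective (by simpa using h0))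
  have hadj := A.pow_dvd_adjugate_of_isRelPrime (toC f) (A 0 0) hfa _ _ hA.dvd_sub
  refine ⟨hadj, ?_⟩
  have hadjh := isHomogeneous_adjugate A hA.homogeneous
  have hdeth := isHomogeneous_det A hA.homogeneous
  simp only [Nat.add_sub_cancel] at hadjh hdeth
  rcases Nat.eq_zero_or_pos n with rfl | hn
  -- For `d = 1` the adjugate is `(1)`, so `M = (f)` and `γ = 1`.
  · refine ⟨toC f • A.adjugate, by simp, fun i j => ?_, 1, ?_⟩
    · simpa [Matrix.smul_apply] using hfC.mul (hadjh i j)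
    · simp
  obtain ⟨q, hq⟩ := A.pow_dvd_det_of_isRelPrime (toC f) (A 0 0) hfa _ _ hA.dvd_sub
  simp only [Nat.add_sub_cancel] at hq
  -- Both `det A` and `f ^ n` have degree `n * (n + 1)`.
  have hq0 : q.IsHomogeneous 0 := by
    refine (hfC.pow n).of_mul_left (pow_ne_zero _ hfC0) ?_
    rw [← hq]
    simpa using hdeth
  obtain ⟨c, rfl⟩ : ∃ c, q = C c :=
    ⟨_, totalDegree_eq_zero_iff_eq_C.mp (Nat.le_zero.mp hq0.totalDegree_le)⟩
  obtain ⟨γ, rfl⟩ : ∃ γ : ℝ, (γ : ℂ) = c := by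
    refine exists_real_of_conjPoly_eq (f := f ^ n) (pow_ne_zero _ hf0) ?_
    have h1 : C c * toC (f ^ n) = A.det := by rw [hq, toC, map_pow, mul_comm]
    rw [h1]
    exact conjPoly_det hA.hermitian
  choose M hM using hadj
  have hM' : A.adjugate = toC f ^ (n - 1) • Matrix.of M := by
    ext1 i j
    simp [hM]
  -- The exponent comes from `det (adj A) = (det A) ^ n`, after cancelling `f ^ ((n - 1) * (n + 1))`
  -- from `f ^ (n * n)`.
  refine ⟨Matrix.of M, ?_, fun i j => ?_, γ ^ n, ?_⟩
  · rw [hM', smul_smul, ← pow_succ', Nat.sub_add_cancel hn]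
  · refine (hfC.pow (n - 1)).of_mul_left (pow_ne_zero _ hfC0) ?_
    have : (n + 1) * (n - 1) + 1 = n * n := by
      obtain ⟨m, rfl⟩ := Nat.exists_eq_add_of_lt hn
      simp
      ring
    rw [this]
    simpa [hM] using hadjh i j
  · have h1 := A.det_adjugate
    rw [hM', Matrix.det_smul, hq, Fintype.card_fin, Nat.add_sub_cancel, mul_pow, ← pow_mul,
      ← pow_mul] at h1
    have h2 : n * n = (n - 1) * (n + 1) + 1 := by
      obtain ⟨m, rfl⟩ := Nat.exists_eq_add_of_lt hn
      simp
      ring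
    rw [h2, pow_succ, mul_assoc] at h1
    rw [mul_left_cancel₀ (pow_ne_zero _ hfC0) h1]
    simp [mul_comm]

end PlaneCurve

/-! ### Restriction to lines and generic lines -/

namespace PlaneCurve
open MvPolynomial

section LineSubst

variable {σ k S : Type*} [CommRing k] [CommRing S] [Algebra k S]

/-- The substitution `x ↦ t e + a`. -/
noncomputable def lineSubst (e a : σ → S) : MvPolynomial σ k →ₐ[k] Polynomial S :=
  aeval fun i => Polynomial.X * Polynomial.C (e i) + Polynomial.C (a i)

theorem eval_lineSubst (e a : σ → S) (g : MvPolynomial σ k) (t : S) :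
    (lineSubst e a g).eval t = aeval (fun i => t * e i + a i) g := by
  have : ((Polynomial.aeval t).restrictScalars k).comp (lineSubst e a) =
      aeval (R := k) fun i => t * e i + a i := by
    ext1 i
    simp [lineSubst]
    exact mul_comm _ _
  simpa [← Polynomial.coe_aeval_eq_eval] using DFunLike.congr_fun this g

theorem map_lineSubst {T : Type*} [CommRing T] [Algebra k T] (φ : S →ₐ[k] T) (e a : σ → S)
    (g : MvPolynomial σ k) :
    (lineSubst e a g).map (φ : S →+* T) = lineSubst (fun i => φ (e i)) (fun i => φ (a i)) g := by
  have : (Polynomial.mapAlgHom φ).comp (lineSubst e a) =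
      lineSubst (k := k) (fun i => φ (e i)) (fun i => φ (a i)) := by
    ext1 i
    simp [lineSubst]
  simpa using DFunLike.congr_fun this g

/-- Each monomial becomes a product of `m` polynomials `e i * t + a i`, up to a constant, so the
coefficient of `t ^ m` is the value at `e`, whether or not it vanishes. -/
theorem lineSubst_degree_le_and_coeff (e a : σ → S) {g : MvPolynomial σ k} {m : ℕ}
    (hg : g.IsHomogeneous m) :
    (lineSubst e a g).natDegree ≤ m ∧ (lineSubst e a g).coeff m = aeval e g := by
  have key : ∀ s ∈ g.support,
      (lineSubst e a (monomial s (g.coeff s))).natDegree ≤ m ∧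
      (lineSubst e a (monomial s (g.coeff s))).coeff m = aeval e (monomial s (g.coeff s)) := by
    intro s hs
    have hlin : ∀ i, (Polynomial.X * Polynomial.C (e i) + Polynomial.C (a i)).natDegree ≤ 1 := by
      intro i
      compute_degree
    have hm : m = ∑ i ∈ s.support, s i := by
      rw [← Finsupp.degree_apply]
      by_contra h
      exact mem_support_iff.mp hs (hg.coeff_eq_zero fun h' => h h'.symm)
    have hprod : ∀ u : Finset σ,
        (∏ i ∈ u, (Polynomial.X * Polynomial.C (e i) + Polynomial.C (a i)) ^ s i).natDegree ≤
          ∑ i ∈ u, s i ∧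
        (∏ i ∈ u, (Polynomial.X * Polynomial.C (e i) + Polynomial.C (a i)) ^ s i).coeff
          (∑ i ∈ u, s i) = ∏ i ∈ u, e i ^ s i := by
      intro u
      induction u using Finset.cons_induction with
      | empty => simp
      | cons i u hi ih =>
        have h1 : ((Polynomial.X * Polynomial.C (e i) + Polynomial.C (a i)) ^ s i).natDegree ≤
            s i := by
          simpa using Polynomial.natDegree_pow_le_of_le (s i) (hlin i)
        have h2 : ((Polynomial.X * Polynomial.C (e i) + Polynomial.C (a i)) ^ s i).coeff (s i) =
            e i ^ s i := by
          simpa using Polynomial.coeff_pow_of_natDegree_le (m := s i) (hlin i)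
        rw [Finset.prod_cons, Finset.sum_cons, Finset.prod_cons]
        exact ⟨Polynomial.natDegree_mul_le_of_le h1 ih.1,
          by rw [Polynomial.coeff_mul_add_eq_of_natDegree_le h1 ih.1, h2, ih.2]⟩
    rw [lineSubst, aeval_monomial, aeval_monomial, Finsupp.prod, Finsupp.prod, hm,
      Polynomial.algebraMap_apply]
    exact ⟨(Polynomial.natDegree_C_mul_le _ _).trans (hprod _).1,
      by rw [Polynomial.coeff_C_mul, (hprod _).2]⟩
  rw [g.as_sum, map_sum, map_sum, Polynomial.finsetSum_coeff]
  exact ⟨Polynomial.natDegree_sum_le_of_forall_le _ _ fun s hs => (key s hs).1,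
    Finset.sum_congr rfl fun s hs => (key s hs).2⟩

end LineSubst

section Generic

variable {σ k : Type*} [Field k]

/-- The endomorphism `x ↦ t c + x`, `t ↦ t` of `k[x][t]`. -/
noncomputable def shear (c : σ → k) :
    Polynomial (MvPolynomial σ k) →+* Polynomial (MvPolynomial σ k) :=
  Polynomial.eval₂RingHom (lineSubst (fun i => C (c i)) X : MvPolynomial σ k →ₐ[k] _).toRingHom
    Polynomial.X

theorem shear_shear_neg (c : σ → k) (P : Polynomial (MvPolynomial σ k)) :
    shear c (shear (-c) P) = P := by
  have : (shear c).comp (shear (-c)) = RingHom.id _ := by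
    refine Polynomial.ringHom_ext' (MvPolynomial.ringHom_ext (fun r => ?_) fun i => ?_) ?_ <;>
      simp [shear, lineSubst, Polynomial.algebraMap_apply, MvPolynomial.algebraMap_eq]
  exact DFunLike.congr_fun this P

theorem shear_C (c : σ → k) (g : MvPolynomial σ k) :
    shear c (Polynomial.C g) = lineSubst (fun i => C (c i)) X g := by
  simp [shear]

theorem isRelPrime_C {R : Type*} [CommRing R] [IsDomain R] {f g : R} (hf : f ≠ 0)
    (h : IsRelPrime f g) : IsRelPrime (Polynomial.C f) (Polynomial.C g) := by
  intro P hPf hPg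
  have hdeg := Polynomial.natDegree_le_of_dvd hPf (Polynomial.C_ne_zero.mpr hf)
  rw [Polynomial.natDegree_C, Nat.le_zero] at hdeg
  obtain ⟨r, rfl⟩ := Polynomial.natDegree_eq_zero.mp hdeg
  rw [Polynomial.C_dvd_iff_dvd_coeff] at hPf hPg
  exact (h (by simpa using hPf 0) (by simpa using hPg 0)).map Polynomial.C

/-- `shear c` is an automorphism with inverse `shear (-c)`, and it carries the constant polynomials
`f`, `g` to their restrictions to the universal line. -/
theorem isRelPrime_lineSubst {f g : MvPolynomial σ k} (hf : f ≠ 0) (h : IsRelPrime f g)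
    (c : σ → k) : IsRelPrime (lineSubst (fun i => C (c i)) X f : Polynomial (MvPolynomial σ k))
      (lineSubst (fun i => C (c i)) X g) := by
  intro P hPf hPg
  rw [← shear_C] at hPf hPg
  have back : ∀ q, shear (-c) (shear c q) = q := fun q => by
    simpa using shear_shear_neg (-c) q
  have h1 := map_dvd (shear (-c)) hPf
  have h2 := map_dvd (shear (-c)) hPg
  rw [back] at h1 h2
  rw [← shear_shear_neg c P]
  exact (isRelPrime_C hf h h1 h2).map _

end Generic

/-- Relatively prime polynomials, one of them primitive, combine to a nonzero constant. -/
theorem exists_bezout {R : Type*} [CommRing R] [IsDomain R] [UniqueFactorizationMonoid R]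
    {F G : Polynomial R} (hF : F.IsPrimitive) (h : IsRelPrime F G) :
    ∃ (U V : Polynomial R) (r : R), r ≠ 0 ∧ U * F + V * G = Polynomial.C r := by
  have : Nonempty (NormalizedGCDMonoid R) := inferInstance
  let _ : NormalizedGCDMonoid R := this.some
  let K := FractionRing R
  have hinj : Function.Injective (algebraMap R K) := IsFractionRing.injective R K
  have hcop : IsCoprime (F.map (algebraMap R K)) (G.map (algebraMap R K)) := by
    -- Gauss's lemma: the primitive part of a common factor over `K`, once its denominators are
    -- cleared, divides `F` and `G` over `R`.
    refine IsRelPrime.isCoprime fun q hqF hqG => ?_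
    have hq0 : q ≠ 0 := by
      rintro rfl
      exact hF.ne_zero ((Polynomial.map_eq_zero_iff hinj).mp (zero_dvd_iff.mp hqF))
    set N := IsLocalization.integerNormalization (nonZeroDivisors R) q with hN
    obtain ⟨b, hb0, hb⟩ := IsLocalization.integerNormalization_spec (nonZeroDivisors R) q
    have hbK : algebraMap R K b ≠ 0 :=
      IsFractionRing.to_map_ne_zero_of_mem_nonZeroDivisors hb0
    have hbq : N.map (algebraMap R K) = Polynomial.C (algebraMap R K b) * q := by
      rw [hb, Polynomial.C_mul', algebraMap_smul]
    have hdvd : ∀ H : Polynomial R, q ∣ H.map (algebraMap R K) →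
        N.primPart.map (algebraMap R K) ∣ H.map (algebraMap R K) := by
      intro H hH
      have h1 : N.primPart.map (algebraMap R K) ∣ Polynomial.C (algebraMap R K b) * q := by
        rw [← hbq]
        exact Polynomial.map_dvd _ N.primPart_dvd
      exact (((Polynomial.isUnit_C.mpr hbK.isUnit).dvd_mul_left).mp h1).trans hH
    have hu := h (N.isPrimitive_primPart.dvd_of_fraction_map_dvd_fraction_map (hdvd F hqF))
      (N.isPrimitive_primPart.dvd_of_fraction_map_dvd_fraction_map (hdvd G hqG))
    exact Polynomial.isUnit_or_eq_zero_of_isUnit_integerNormalization_primPart hq0 hu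
  obtain ⟨u, v, huv⟩ := hcop
  obtain ⟨b, hb0, hb⟩ := IsLocalization.integerNormalization_spec (nonZeroDivisors R) u
  obtain ⟨c, hc0, hc⟩ := IsLocalization.integerNormalization_spec (nonZeroDivisors R) v
  refine ⟨Polynomial.C c * IsLocalization.integerNormalization (nonZeroDivisors R) u,
    Polynomial.C b * IsLocalization.integerNormalization (nonZeroDivisors R) v, b * c,
    mul_ne_zero (nonZeroDivisors.ne_zero hb0) (nonZeroDivisors.ne_zero hc0), ?_⟩
  apply Polynomial.map_injective _ hinj
  have hsmul : ∀ (s : R) (w : Polynomial K), s • w = Polynomial.C (algebraMap R K s) * w :=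
    fun s w => by rw [Polynomial.C_mul', algebraMap_smul]
  simp only [Polynomial.map_add, Polynomial.map_mul, Polynomial.map_C, hb, hc, map_mul, hsmul]
  linear_combination (Polynomial.C (algebraMap R K b) * Polynomial.C (algebraMap R K c)) * huv

/-- For `a` outside a hypersurface, relatively prime forms have no common zero on the line
`a + t e`. -/
theorem exists_generic {σ k : Type*} [Field k] {f g : MvPolynomial σ k} {m : ℕ}
    (hf : f.IsHomogeneous m) (h : IsRelPrime f g) (e : σ → k) (he : eval e f ≠ 0) :
    ∃ r : MvPolynomial σ k, r ≠ 0 ∧ ∀ a : σ → k, eval a r ≠ 0 → ∀ t : k,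
      ¬ (eval (fun i => t * e i + a i) f = 0 ∧ eval (fun i => t * e i + a i) g = 0) := by
  have hf0 : f ≠ 0 := by
    rintro rfl
    simp at he
  have hlc := (lineSubst_degree_le_and_coeff (fun i => C (e i)) (X : σ → MvPolynomial σ k) hf).2
  have hae : aeval (fun i => C (e i) : σ → MvPolynomial σ k) f = C (eval e f) := by
    rw [← coe_aeval_eq_eval]
    have : aeval (fun i => C (e i) : σ → MvPolynomial σ k) =
        (Algebra.ofId k (MvPolynomial σ k)).comp (aeval e) := by
      ext1 i
      simp [Algebra.ofId_apply, MvPolynomial.algebraMap_eq]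
    rw [this]
    simp [Algebra.ofId_apply, MvPolynomial.algebraMap_eq]
  -- The coefficient of `t ^ m` is the nonzero constant `f(e)`, a unit.
  have hprim : (lineSubst (fun i => C (e i)) X f : Polynomial (MvPolynomial σ k)).IsPrimitive := by
    intro s hs
    refine isUnit_of_dvd_unit ((Polynomial.C_dvd_iff_dvd_coeff _ _).mp hs m) ?_
    rw [hlc, hae]
    exact he.isUnit.map C
  obtain ⟨U, V, r, hr, hUV⟩ := exists_bezout hprim (isRelPrime_lineSubst hf0 h e)
  refine ⟨r, hr, fun a ha t ⟨h1, h2⟩ => ha ?_⟩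
  have hev : ∀ p : MvPolynomial σ k,
      ((lineSubst (fun i => C (e i)) X p : Polynomial (MvPolynomial σ k)).map
        (eval a)).eval t = eval (fun i => t * e i + a i) p := by
    intro p
    have := map_lineSubst (aeval a : MvPolynomial σ k →ₐ[k] k) (fun i => C (e i)) X p
    have h3 : ((aeval a : MvPolynomial σ k →ₐ[k] k) : MvPolynomial σ k →+* k) = eval a := by
      ext <;> simp
    rw [h3] at this
    rw [this, eval_lineSubst, ← coe_aeval_eq_eval]
    simp
  have := congrArg (fun p => (p.map (eval a)).eval t) hUV
  simpa [hev, h1, h2] using this.symm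

end PlaneCurve

/-! ### Interlacing and definiteness -/

namespace PlaneCurve
open MvPolynomial

/-- The factors pair off with equal signs: `β j` lies strictly between `α j` and `α (j + 1)`, and
`i.succAbove j` selects the one of these two farther from `α i`. -/
theorem interlacing_prod_pos {n : ℕ} {α : Fin (n + 1) → ℝ} {β : Fin n → ℝ} (hα : Monotone α)
    (hαβ : ∀ i : Fin n, α i.castSucc ≤ β i ∧ β i ≤ α i.succ) (hne : ∀ i j, α i ≠ β j)
    (i : Fin (n + 1)) : 0 < (∏ j, (α i - β j)) * ∏ j ∈ Finset.univ.erase i, (α i - α j) := by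
  have herase : ∏ j ∈ Finset.univ.erase i, (α i - α j) = ∏ j : Fin n, (α i - α (i.succAbove j)) := by
    rw [← Finset.compl_singleton, ← Fin.image_succAbove_univ,
      Finset.prod_image fun _ _ _ _ h => Fin.succAbove_right_injective h]
  rw [herase, ← Finset.prod_mul_distrib]
  refine Finset.prod_pos fun j _ => ?_
  have h1 := (hαβ j).1.lt_of_ne (hne _ _)
  have h2 := (hαβ j).2.lt_of_ne (hne _ _).symm
  rcases lt_or_ge j.castSucc i with h | h
  · rw [Fin.succAbove_of_castSucc_lt _ _ h]
    have h3 : α j.succ ≤ α i := hα (Fin.castSucc_lt_iff_succ_le.mp h)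
    exact mul_pos (by linarith) (by linarith)
  · rw [Fin.succAbove_of_le_castSucc _ _ h]
    have h3 : α i ≤ α j.castSucc := hα h
    exact mul_pos_of_neg_of_neg (by linarith) (by linarith)

theorem interlacing_injective {n : ℕ} {α : Fin (n + 1) → ℝ} {β : Fin n → ℝ}
    (hαβ : ∀ i : Fin n, α i.castSucc ≤ β i ∧ β i ≤ α i.succ) (hne : ∀ i j, α i ≠ β j) :
    Function.Injective α :=
  (Fin.strictMono_iff_lt_succ.mpr fun i =>
    ((hαβ i).1.lt_of_ne (hne _ _)).trans ((hαβ i).2.lt_of_ne (hne _ _).symm)).injective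

/-- If `h * q` takes the values `‖ℓᵢ‖²` at the roots of a polynomial that `q` strictly interlaces,
then the leading coefficients of `h` and `q` have the same sign. -/
theorem interlacing_leadingCoeff {n : ℕ} {α : Fin (n + 1) → ℝ} {β : Fin n → ℝ} (hα : Monotone α)
    (hαβ : ∀ i : Fin n, α i.castSucc ≤ β i ∧ β i ≤ α i.succ) (hne : ∀ i j, α i ≠ β j)
    {c : ℝ} (hc : c ≠ 0) {h : Polynomial ℂ} (hdeg : h.natDegree ≤ n) (l : Fin (n + 1) → ℂ)
    (hl : ∀ i, ((c * ∏ j, (α i - β j) : ℝ) : ℂ) * h.eval (α i : ℂ) = Complex.normSq (l i)) :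
    ∃ r : ℝ, 0 ≤ r ∧ c * h.coeff n = r ∧ (r = 0 → ∀ i, l i = 0) := by
  have hpos := interlacing_prod_pos hα hαβ hne
  have hinj := interlacing_injective hαβ hne
  have hnn : ∀ i ∈ Finset.univ, 0 ≤ Complex.normSq (l i) /
      ((∏ j, (α i - β j)) * ∏ j ∈ Finset.univ.erase i, (α i - α j)) :=
    fun i _ => div_nonneg (Complex.normSq_nonneg _) (hpos i).le
  -- Lagrange's formula for the coefficient of degree `n`, with `h (α i)` replaced through `hl`.
  refine ⟨∑ i, Complex.normSq (l i) /
    ((∏ j, (α i - β j)) * ∏ j ∈ Finset.univ.erase i, (α i - α j)),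
    Finset.sum_nonneg hnn, ?_, fun h0 i => ?_⟩
  · have hcoeff := Lagrange.coeff_eq_sum (s := Finset.univ) (v := fun i => (α i : ℂ)) (P := h)
      (fun i _ j _ hij => hinj (Complex.ofReal_injective hij))
      (by
        rw [Finset.card_univ, Fintype.card_fin]
        exact (Polynomial.degree_le_of_natDegree_le hdeg).trans_lt (by exact_mod_cast n.lt_succ_self))
    rw [Finset.card_univ, Fintype.card_fin, Nat.add_sub_cancel] at hcoeff
    rw [hcoeff, Finset.mul_sum, Complex.ofReal_sum]
    refine Finset.sum_congr rfl fun i _ => ?_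
    have hB : ((∏ j, (α i - β j) : ℝ) : ℂ) ≠ 0 :=
      Complex.ofReal_ne_zero.mpr (left_ne_zero_of_mul (hpos i).ne')
    have hW : ((∏ j ∈ Finset.univ.erase i, (α i - α j) : ℝ) : ℂ) ≠ 0 :=
      Complex.ofReal_ne_zero.mpr (right_ne_zero_of_mul (hpos i).ne')
    have hW' : ∏ j ∈ Finset.univ.erase i, ((α i : ℂ) - α j) =
        ((∏ j ∈ Finset.univ.erase i, (α i - α j) : ℝ) : ℂ) := by
      push_cast
      rfl
    rw [hW', Complex.ofReal_div, Complex.ofReal_mul, ← hl i, Complex.ofReal_mul]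
    field_simp
  · have := (Finset.sum_eq_zero_iff_of_nonneg hnn).mp h0 i (Finset.mem_univ i)
    exact Complex.normSq_eq_zero.mp ((div_eq_zero_iff.mp this).resolve_right (hpos i).ne')

theorem eval_toC (g : Poly3 ℝ) (p : Fin 3 → ℝ) :
    eval (fun i => (p i : ℂ)) (toC g) = ((eval p g : ℝ) : ℂ) := by
  have : (eval fun i => (p i : ℂ)).comp (map (algebraMap ℝ ℂ)) =
      (algebraMap ℝ ℂ).comp (eval p) := by
    refine MvPolynomial.ringHom_ext (fun r => ?_) fun i => ?_ <;> simp
  exact DFunLike.congr_fun this g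

theorem eval_conjPoly (g : Poly3 ℂ) (p : Fin 3 → ℝ) :
    eval (fun i => (p i : ℂ)) (conjPoly g) = starRingEnd ℂ (eval (fun i => (p i : ℂ)) g) := by
  have : (eval fun i => (p i : ℂ)).comp (map (starRingEnd ℂ)) =
      (starRingEnd ℂ).comp (eval fun i => (p i : ℂ)) := by
    refine MvPolynomial.ringHom_ext (fun r => ?_) fun i => ?_ <;> simp
  exact DFunLike.congr_fun this g

theorem restrictLine_eq_lineSubst (g : Poly3 ℝ) (e a : Fin 3 → ℝ) :
    restrictLine g e a = lineSubst e a g := rfl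

/-- The real points are Zariski dense in `ℂ³`. -/
theorem eq_zero_of_eval_real {g : Poly3 ℂ}
    (h : ∀ a : Fin 3 → ℝ, eval (fun i => (a i : ℂ)) g = 0) : g = 0 := by
  refine MvPolynomial.funext_set (fun _ => Set.range ((↑) : ℝ → ℂ))
    (fun _ => Set.infinite_range_of_injective Complex.ofReal_injective) fun x hx => ?_
  choose a ha using fun i => hx i (Set.mem_univ i)
  obtain rfl : (fun i => (a i : ℂ)) = x := _root_.funext ha
  rw [h a, map_zero]

theorem eval_eq_prod_of_roots {n : ℕ} {q : Polynomial ℝ} {β : Fin n → ℝ}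
    (hdeg : q.degree = (n : WithBot ℕ)) (hroots : q.roots = Finset.univ.val.map β) (t : ℝ) :
    q.eval t = q.leadingCoeff * ∏ j, (t - β j) := by
  have hcard : q.roots.card = q.natDegree := by
    rw [hroots, Polynomial.natDegree_eq_of_degree_eq_some hdeg]
    simp
  conv_lhs => rw [← Polynomial.C_leadingCoeff_mul_prod_multiset_X_sub_C hcard, hroots,
    Multiset.map_map]
  change (Polynomial.C q.leadingCoeff * ∏ j, (Polynomial.X - Polynomial.C (β j))).eval t = _
  simp [Polynomial.eval_prod]

/-- If `a g = |ℓ|²` on the real points of a curve that `a` interlaces, then `a(e) g(e)` is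
nonnegative, and positive unless `ℓ = 0`. -/
theorem InterlacesAt.nonneg {n : ℕ} {f a : Poly3 ℝ} {e : Fin 3 → ℝ} (hinter : InterlacesAt (n + 1) a f e)
    (hf : f.IsHomogeneous (n + 1)) (hfa : IsRelPrime (toC f) (toC a)) {g l : Poly3 ℂ}
    (hg : g.IsHomogeneous n) (hl : l.IsHomogeneous n)
    (hgl : toC f ∣ toC a * g - conjPoly l * l) :
    ∃ r : ℝ, 0 ≤ r ∧ (eval e a : ℂ) * eval (fun i => (e i : ℂ)) g = r ∧ (r = 0 → l = 0) := by
  obtain ⟨⟨hfe, -⟩, ha, hinter⟩ := hinter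
  rw [Nat.add_sub_cancel] at ha
  obtain ⟨ρ, hρ0, hρ⟩ := exists_generic (hf.map (algebraMap ℝ ℂ)) hfa (fun i => (e i : ℂ))
    (by rw [eval_toC]; exact_mod_cast hfe)
  set eC : Fin 3 → ℂ := fun i => (e i : ℂ) with heC
  have key : ∀ b : Fin 3 → ℝ, eval (fun i => (b i : ℂ)) ρ ≠ 0 →
      ∃ r : ℝ, 0 ≤ r ∧ (eval e a : ℂ) * eval eC g = r ∧
        (r = 0 → eval (fun i => (b i : ℂ)) l = 0) := by
    intro b hb
    obtain ⟨m, α, β, hfd, had, hα, -, hfr, har, hαβ⟩ := hinter b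
    rw [restrictLine_eq_lineSubst] at hfd had hfr har
    have hf0 : lineSubst e b f ≠ 0 := by
      rw [← Polynomial.degree_ne_bot, hfd]
      exact WithBot.natCast_ne_bot _
    have ha0 : lineSubst e b a ≠ 0 := by
      rw [← Polynomial.degree_ne_bot, had]
      exact WithBot.natCast_ne_bot _
    have hmn : m = n := by
      have h1 := lineSubst_degree_le_and_coeff e b hf
      have h2 := Polynomial.natDegree_eq_of_degree_eq_some hfd
      have h3 := Polynomial.le_natDegree_of_ne_zero (p := lineSubst e b f) (n := n + 1)
        (by rw [h1.2]; simpa [aeval_eq_eval] using hfe)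
      omega
    subst hmn
    have hac : (lineSubst e b a).leadingCoeff = eval e a := by
      rw [Polynomial.leadingCoeff, Polynomial.natDegree_eq_of_degree_eq_some had,
        (lineSubst_degree_le_and_coeff e b ha).2, aeval_eq_eval]
    have hc : eval e a ≠ 0 := by
      rw [← hac]
      exact Polynomial.leadingCoeff_ne_zero.mpr ha0
    have hcast : ∀ t : ℝ, (fun i => (t : ℂ) * eC i + (b i : ℂ)) =
        fun i => (((fun i => t * e i + b i) i : ℝ) : ℂ) := by
      intro t
      funext i
      simp [heC]
    have hfα : ∀ i, eval (fun k => α i * e k + b k) f = 0 := by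
      intro i
      have : α i ∈ (lineSubst e b f).roots := by
        rw [hfr]
        exact Multiset.mem_map.mpr ⟨i, Finset.mem_univ_val i, rfl⟩
      have h1 := (Polynomial.mem_roots hf0).mp this
      rwa [Polynomial.IsRoot, eval_lineSubst, aeval_eq_eval] at h1
    have haval : ∀ t : ℝ, eval (fun k => t * e k + b k) a = eval e a * ∏ j, (t - β j) := by
      intro t
      rw [← hac, ← eval_eq_prod_of_roots had har, eval_lineSubst, aeval_eq_eval]
    -- An equality would be a common zero of `f` and `a` on the line through `b`, which `ρ(b) ≠ 0`
    -- excludes.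
    have hne : ∀ i j, α i ≠ β j := by
      intro i j hij
      refine hρ _ hb (α i) ⟨?_, ?_⟩
      · rw [hcast, eval_toC, hfα, Complex.ofReal_zero]
      · rw [hcast, eval_toC, haval, Finset.prod_eq_zero (Finset.mem_univ j) (sub_eq_zero.mpr hij),
          mul_zero, Complex.ofReal_zero]
    have hgd := lineSubst_degree_le_and_coeff eC (fun i => (b i : ℂ)) hg
    have hld := lineSubst_degree_le_and_coeff eC (fun i => (b i : ℂ)) hl
    obtain ⟨r, hr, hrg, hrl⟩ := interlacing_leadingCoeff hα hαβ hne hc hgd.1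
      (fun i => (lineSubst eC (fun i => (b i : ℂ)) l).eval (α i : ℂ)) fun i => by
        obtain ⟨q, hq⟩ := hgl
        have h1 := congrArg (eval fun k => (((fun k => α i * e k + b k) k : ℝ) : ℂ)) hq
        rw [map_mul, map_sub, map_mul, map_mul, eval_toC, eval_toC, hfα, eval_conjPoly,
          haval, Complex.ofReal_zero, zero_mul, sub_eq_zero] at h1
        rw [eval_lineSubst, eval_lineSubst, aeval_eq_eval, hcast, h1, Complex.normSq_eq_conj_mul_self]
    refine ⟨r, hr, ?_, fun h0 => ?_⟩
    · rw [← hrg, hgd.2, aeval_eq_eval]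
    -- On the line `l` has degree at most `n` and vanishes at `n + 1` distinct points; `t = 0` is
    -- the point `b`.
    · have hz : lineSubst eC (fun i => (b i : ℂ)) l = 0 :=
        Polynomial.eq_zero_of_natDegree_lt_card_of_eval_eq_zero _
          (fun i j hij => interlacing_injective hαβ hne (Complex.ofReal_injective hij))
          (hrl h0) (by rw [Fintype.card_fin]; exact Nat.lt_succ_of_le hld.1)
      have := eval_lineSubst eC (fun i => (b i : ℂ)) l 0
      rw [hz, Polynomial.eval_zero, aeval_eq_eval] at this
      simpa using this.symm
  have hex : ∃ b : Fin 3 → ℝ, eval (fun i => (b i : ℂ)) ρ ≠ 0 := by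
    by_contra! h
    exact hρ0 (eq_zero_of_eval_real h)
  obtain ⟨b, hb⟩ := hex
  obtain ⟨r, hr, hrg, -⟩ := key b hb
  refine ⟨r, hr, hrg, fun h0 => ?_⟩
  -- The number `r = a(e) g(e)` is the same for all `b`, so `r = 0` makes `l` vanish wherever `ρ`
  -- does not.
  have : ρ * l = 0 := by
    refine eq_zero_of_eval_real fun b => ?_
    rw [map_mul]
    by_cases hb : eval (fun i => (b i : ℂ)) ρ = 0
    · rw [hb, zero_mul]
    · obtain ⟨r', -, hrg', hl'⟩ := key b hb
      have : r' = r := Complex.ofReal_injective (hrg'.symm.trans hrg)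
      rw [hl' (this.trans h0), mul_zero]
  exact (mul_eq_zero.mp this).resolve_left hρ0

/-- A Dixon matrix whose corner entry interlaces `f` is definite at `e`. -/
theorem IsDixonMatrix.posDef {n : ℕ} {f a : Poly3 ℝ} {D : P2 →₀ ℤ}
    {A : Matrix (Fin (n + 1)) (Fin (n + 1)) (Poly3 ℂ)} (hA : IsDixonMatrix f D A)
    (hf : f.IsHomogeneous (n + 1)) (ha : A 0 0 = toC a) {e : Fin 3 → ℝ}
    (hinter : InterlacesAt (n + 1) a f e) : (eval e a • evalMatrix A e).PosDef := by
  have hfa : IsRelPrime (toC f) (toC a) := by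
    obtain ⟨a', ha', h, -⟩ := hA.corner
    rwa [← ha, ha']
  rw [Matrix.posDef_iff_dotProduct_mulVec]
  refine ⟨?_, fun x hx => ?_⟩
  · ext j k
    rw [Matrix.conjTranspose_apply, Matrix.smul_apply, Matrix.smul_apply, evalMatrix,
      Matrix.map_apply, Matrix.map_apply, hA.hermitian j k, eval_conjPoly]
    simp
  set l : Poly3 ℂ := ∑ k, C (x k) * A 0 k with hl
  set g : Poly3 ℂ := ∑ j, ∑ k, C (starRingEnd ℂ (x j)) * C (x k) * A j k with hg
  have hgh : g.IsHomogeneous n := IsHomogeneous.sum _ _ _ fun j _ => IsHomogeneous.sum _ _ _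
    fun k _ => by
      rw [← map_mul]
      exact (hA.homogeneous j k).C_mul _
  have hlh : l.IsHomogeneous n :=
    IsHomogeneous.sum _ _ _ fun k _ => (hA.homogeneous 0 k).C_mul _
  have hl0 : l ≠ 0 := by
    intro h0
    refine hx (funext (Fintype.linearIndependent_iff.mp hA.row_indep x ?_))
    rw [← h0, hl]
    simp [C_mul']
  have hgl : toC f ∣ toC a * g - conjPoly l * l := by
    have : toC a * g - conjPoly l * l = ∑ j, ∑ k, C (starRingEnd ℂ (x j)) * C (x k) *
        (A 0 0 * A j k - conjPoly (A 0 j) * A 0 k) := by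
      have hcl : conjPoly l = ∑ j, C (starRingEnd ℂ (x j)) * conjPoly (A 0 j) := by
        rw [hl, conjPoly, map_sum]
        simp
      rw [hcl, hl, hg, Finset.sum_mul_sum, Finset.mul_sum, ← Finset.sum_sub_distrib]
      refine Finset.sum_congr rfl fun j _ => ?_
      rw [Finset.mul_sum, ← Finset.sum_sub_distrib]
      refine Finset.sum_congr rfl fun k _ => ?_
      rw [ha]
      ring
    rw [this]
    exact Finset.dvd_sum fun j _ => Finset.dvd_sum fun k _ => (hA.dvd_sub j k).mul_left _
  obtain ⟨r, hr, hrg, hrl⟩ := hinter.nonneg hf hfa hgh hlh hgl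
  have hval : star x ⬝ᵥ (eval e a • evalMatrix A e).mulVec x = (r : ℂ) := by
    rw [← hrg, hg, map_sum, Finset.mul_sum, dotProduct]
    refine Finset.sum_congr rfl fun j _ => ?_
    rw [map_sum, Finset.mul_sum, Matrix.mulVec, dotProduct, Finset.mul_sum]
    refine Finset.sum_congr rfl fun k _ => ?_
    simp [evalMatrix]
    ring
  rw [hval]
  exact_mod_cast hr.lt_of_ne fun h => hl0 (hrl h.symm)

theorem evalMatrix_smul_eq {n : ℕ} {f : Poly3 ℝ}
    {A M : Matrix (Fin (n + 1)) (Fin (n + 1)) (Poly3 ℂ)}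
    (h : toC f ^ n • M = toC f • A.adjugate) (e : Fin 3 → ℝ) :
    ((eval e f : ℝ) : ℂ) ^ n • evalMatrix M e =
      ((eval e f : ℝ) : ℂ) • (evalMatrix A e).adjugate := by
  have hadj : (evalMatrix A e).adjugate = evalMatrix A.adjugate e :=
    ((eval fun i => (e i : ℂ)).map_adjugate A).symm
  rw [hadj]
  ext i j
  have := congrArg (eval fun i => (e i : ℂ)) (congrFun (congrFun h i) j)
  simpa only [Matrix.smul_apply, smul_eq_mul, map_mul, map_pow, eval_toC, evalMatrix,
    Matrix.map_apply] using this

/-- A multiple of the adjugate of a matrix that is definite up to sign is a real multiple of the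
inverse. -/
theorem exists_eq_smul_inv {n : ℕ} {E N : Matrix (Fin (n + 1)) (Fin (n + 1)) ℂ} {c F : ℝ}
    (hpos : (c • E).PosDef) (hF : F ≠ 0) (h : (F : ℂ) ^ n • N = (F : ℂ) • E.adjugate) :
    ∃ κ : ℝ, κ ≠ 0 ∧ N = (κ : ℂ) • (c • E)⁻¹ := by
  have hc : c ≠ 0 := by
    rintro rfl
    simpa using hpos.diag_pos (i := 0)
  have hc' : (c : ℂ) ≠ 0 := Complex.ofReal_ne_zero.mpr hc
  have hF' : (F : ℂ) ≠ 0 := Complex.ofReal_ne_zero.mpr hF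
  obtain ⟨δ, hδ⟩ : ∃ δ : ℝ, (δ : ℂ) = (c • E).det :=
    ⟨_, (Complex.eq_re_of_ofReal_le (r := 0) (by simpa using hpos.det_pos.le)).symm⟩
  have hδ0 : (δ : ℂ) ≠ 0 := hδ ▸ hpos.det_pos.ne'
  have hcE : c • E = (c : ℂ) • E := by
    ext i j
    simp
  have hadj : (c : ℂ) ^ n • E.adjugate = (δ : ℂ) • (c • E)⁻¹ := by
    rw [Matrix.inv_def, ← hδ, Ring.inverse_eq_inv', smul_smul, mul_inv_cancel₀ hδ0, one_smul, hcE,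
      Matrix.adjugate_smul, Fintype.card_fin, Nat.add_sub_cancel]
  -- From `adj (c E) = c ^ n adj E` and `adj (c E) = δ (c E)⁻¹`.
  refine ⟨F * δ / (F ^ n * c ^ n), ?_, ?_⟩
  · have : δ ≠ 0 := Complex.ofReal_ne_zero.mp hδ0
    positivity
  · have h1 : ((F : ℂ) ^ n * (c : ℂ) ^ n) • N = ((F : ℂ) * δ) • (c • E)⁻¹ := by
      rw [mul_comm, mul_smul, h, smul_comm, hadj, smul_smul]
    push_cast
    rw [div_eq_inv_mul, mul_smul, ← h1, smul_smul, inv_mul_cancel₀, one_smul]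
    exact mul_ne_zero (pow_ne_zero _ hF') (pow_ne_zero _ hc')

end PlaneCurve

theorem mainTheorem2 (d : ℕ) [NeZero d] (f : PlaneCurve.Poly3 ℝ)
    (hf : f.IsHomogeneous d) (hsmooth : PlaneCurve.IsSmooth (PlaneCurve.toC f))
    (D : PlaneCurve.P2 →₀ ℤ) (hD : PlaneCurve.IsRealContactDivisor f D)
    (hdeg : PlaneCurve.divDegree D = (d.choose 2 : ℤ))
    (A : Matrix (Fin d) (Fin d) (PlaneCurve.Poly3 ℂ))
    (hA : PlaneCurve.IsDixonMatrix f D A) :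
    (∀ i j, PlaneCurve.toC f ^ (d - 2) ∣ A.adjugate i j) ∧
    -- The first equation says `M = f ^ (2 - d) • adj A`, for `d = 1` as well as for `2 ≤ d`.
    ∃ M : Matrix (Fin d) (Fin d) (PlaneCurve.Poly3 ℂ),
      PlaneCurve.toC f ^ (d - 1) • M = PlaneCurve.toC f • A.adjugate ∧
      (∀ i j, (M i j).IsHomogeneous 1) ∧
      ∃ γ : ℝ, M.det = MvPolynomial.C (γ : ℂ) * PlaneCurve.toC f ∧
        ∀ (e : Fin 3 → ℝ) (a₁₁ : PlaneCurve.Poly3 ℝ), A 0 0 = PlaneCurve.toC a₁₁ →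
          PlaneCurve.IsHyperbolic f e → PlaneCurve.InterlacesAt d a₁₁ f e →
          γ ≠ 0 ∧ ((PlaneCurve.evalMatrix M e).PosDef ∨ (-PlaneCurve.evalMatrix M e).PosDef) := by
  obtain ⟨n, rfl⟩ := Nat.exists_eq_succ_of_ne_zero (NeZero.ne d)
  have hf0 : f ≠ 0 := by
    rintro rfl
    obtain ⟨i, hi⟩ := hsmooth (fun _ => 1) (fun h => one_ne_zero (congrFun h 0)) (by simp)
    simp at hi
  obtain ⟨hadj, M, hM, hMlin, γ, hγ⟩ := hA.exists_linear hf hf0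
  refine ⟨hadj, M, hM, hMlin, γ, hγ, fun e a ha hhyp hinter => ?_⟩
  have hpos := hA.posDef hf ha hinter
  have hF : MvPolynomial.eval e f ≠ 0 := hhyp.1
  have hMe := PlaneCurve.evalMatrix_smul_eq hM e
  obtain ⟨κ, hκ, hMκ⟩ := PlaneCurve.exists_eq_smul_inv hpos hF hMe
  have hdet : (PlaneCurve.evalMatrix M e).det ≠ 0 := by
    rw [hMκ, Matrix.det_smul]
    exact mul_ne_zero (pow_ne_zero _ (Complex.ofReal_ne_zero.mpr hκ)) hpos.inv.det_pos.ne'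
  refine ⟨?_, ?_⟩
  · rintro rfl
    refine hdet ?_
    rw [PlaneCurve.evalMatrix, ← RingHom.mapMatrix_apply, ← RingHom.map_det, hγ]
    simp
  · rw [hMκ]
    -- The sign of `κ` decides between the two kinds of definiteness.
    rcases hκ.lt_or_gt with h | h
    · right
      rw [← neg_smul, ← Complex.ofReal_neg]
      exact hpos.inv.smul (by exact_mod_cast neg_pos.mpr h)
    · left
      exact hpos.inv.smul (by exact_mod_cast h)
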